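/- For a finite simple undirected graph $G=(V,E)$ and a set $D\subseteq V$ let $$\partial(D)=\Bigl|\Bigl(\bigcup_{x\in D}N(x)\Bigr)\setminus D\Bigr|-|D|,\qquad \partial(G)=\max_{D\subseteq V}\partial(D),$$ where $N(x)$ is the set of neighbours of $x$. The maximisation problem \textsc{Differential} asks, given $G$, for a set $D\subseteq V$ of largest $\partial(D)$. \textsc{Differential} is factor-$\frac{11}{3}$ polynomial-time approximable: there is an algorithm (a Turing machine) that, given any finite simple graph $G$ (encoded by its adjacency matrix), outputs, in time polynomial in the length of the input, a set $D\subseteq V$ with $$\tfrac{11}{3}\,\partial(D)\ \ge\ \partial(G).$$ -/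

import Mathlib

/-- A maximization problem: instances, the feasible solutions of each instance, and the value of a
feasible solution, together with the finite-alphabet words by which a machine reads instances and
writes solutions. -/
structure MaximizationProblem where
  /-- the input instances -/
  Inst : Type
  /-- the feasible solutions of an instance -/
  Sol : Inst → Type
  /-- the value of a feasible solution -/
  m : (x : Inst) → Sol x → ℤ
  /-- the alphabet in which instances are written -/
  InstAlphabet : Type
  instAlphabetFinite : Finite InstAlphabet
  /-- the alphabet in which solutions are written -/
  SolAlphabet : Type
  solAlphabetFinite : Finite SolAlphabet
  /-- the word that represents an instance -/
  encodeInst : Inst → List InstAlphabet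
  encodeInst_injective : Function.Injective encodeInst
  /-- the word that represents a solution of a given instance -/
  encodeSol : (x : Inst) → Sol x → List SolAlphabet
  encodeSol_injective : ∀ x, Function.Injective (encodeSol x)

namespace MaximizationProblem

/-- `v` is the optimum value of the instance `x`: the maximum of the values of its solutions. -/
def IsOptimumValue (P : MaximizationProblem) (x : P.Inst) (v : ℤ) : Prop :=
  IsGreatest (Set.range (P.m x)) v

/-- `y` is an `α`-approximate solution for `x`: the optimum value of `x` exists and is at most
`α` times the value of `y`. -/
def IsApproximateSolution (P : MaximizationProblem) (α : ℝ) (x : P.Inst) (y : P.Sol x) : Prop :=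
  ∃ v : ℤ, P.IsOptimumValue x v ∧ (v : ℝ) ≤ α * (P.m x y : ℝ)

/-- `P` is factor-`α` polynomial-time approximable: some map that sends every instance to an
`α`-approximate solution of it is computed by a Turing machine in a number of steps that is bounded
by a polynomial in the length of the word that represents the instance. -/
def PolyTimeApproximable (P : MaximizationProblem) (α : ℝ) : Prop :=
  ∃ A : (x : P.Inst) → P.Sol x,
    (∀ x, P.IsApproximateSolution α x (A x)) ∧
      Nonempty (Turing.TM2ComputableInPolyTime P.encodeInst (id : List P.SolAlphabet → _)
        (fun x => P.encodeSol x (A x)))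

end MaximizationProblem

/-- The differential `∂(D) = |N(D) \ D| - |D|` of a set `D` of vertices, where `N(D)` is the union
of the neighbourhoods of the vertices of `D`. -/
noncomputable def SimpleGraph.differentialOf {V : Type*} (G : SimpleGraph V) (D : Set V) : ℤ :=
  (((⋃ x ∈ D, G.neighborSet x) \ D).ncard : ℤ) - (D.ncard : ℤ)

/-- The characteristic word of a set of vertices. -/
noncomputable def encodeVertexSet {n : ℕ} (D : Set (Fin n)) : List Bool :=
  open Classical in (List.finRange n).map fun i => decide (i ∈ D)

/-- The adjacency matrix of a graph, written row by row, each row followed by the separator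
`none`. -/
noncomputable def encodeGraph (G : Σ n : ℕ, SimpleGraph (Fin n)) : List (Option Bool) :=
  (List.finRange G.1).flatMap fun i =>
    (encodeVertexSet (G.2.neighborSet i)).map some ++ [none]

theorem encodeVertexSet_length {n : ℕ} (D : Set (Fin n)) : (encodeVertexSet D).length = n := by
  simp [encodeVertexSet]

theorem encodeVertexSet_injective {n : ℕ} :
    Function.Injective (encodeVertexSet : Set (Fin n) → List Bool) := by
  intro D D' h
  ext i
  simp only [encodeVertexSet, List.map_inj_left, List.mem_finRange, true_implies] at h
  simpa using h i

theorem encodeGraph_length (G : Σ n : ℕ, SimpleGraph (Fin n)) :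
    (encodeGraph G).length = G.1 * (G.1 + 1) := by
  simp [encodeGraph, List.length_flatMap, encodeVertexSet_length]

theorem flatMap_inj_of_length {ι β : Type*} {f g : ι → List β} (k : ℕ) (hf : ∀ i, (f i).length = k)
    (hg : ∀ i, (g i).length = k) (l : List ι) (h : l.flatMap f = l.flatMap g) :
    ∀ i ∈ l, f i = g i := by
  induction l with
  | nil => simp
  | cons a l ih =>
    simp only [List.flatMap_cons] at h
    obtain ⟨h1, h2⟩ := List.append_inj h (by rw [hf, hg])
    intro i hi
    rcases List.mem_cons.1 hi with rfl | hi
    · exact h1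
    · exact ih h2 i hi

theorem encodeGraph_injective : Function.Injective encodeGraph := by
  rintro ⟨n, G⟩ ⟨n', G'⟩ h
  have hl := congrArg List.length h
  simp only [encodeGraph_length] at hl
  obtain rfl : n = n' := by
    rcases lt_trichotomy n n' with h | h | h
    · nlinarith
    · exact h
    · nlinarith
  have hrow := flatMap_inj_of_length (n + 1) (by simp [encodeVertexSet_length])
    (by simp [encodeVertexSet_length]) _ h
  have hG : G = G' := by
    ext i j
    have hi := List.append_cancel_right (hrow i (List.mem_finRange i))
    have := encodeVertexSet_injective ((List.map_injective_iff.2 (Option.some_injective _)) hi)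
    exact Set.ext_iff.1 this j
  rw [hG]

/-- The problem Differential: given a finite simple graph, find a set of vertices of largest
differential. Every set of vertices is feasible. -/
noncomputable def differentialProblem : MaximizationProblem where
  Inst := Σ n : ℕ, SimpleGraph (Fin n)
  Sol G := Set (Fin G.1)
  m G D := G.2.differentialOf D
  InstAlphabet := Option Bool
  instAlphabetFinite := inferInstance
  SolAlphabet := Bool
  solAlphabetFinite := inferInstance
  encodeInst := encodeGraph
  encodeInst_injective := encodeGraph_injective
  encodeSol _ D := encodeVertexSet D
  encodeSol_injective _ := encodeVertexSet_injective

/-! ### The greedy algorithm -/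

/-! A one-pass greedy set $S$ is even a factor-3 approximation. Let $C=N[S]$. Each chosen vertex
covers at least three new ones, so $|C|\ge 3|S|$ and $\partial(S)\ge|C|-2|S|\ge|C|/3$
(`ncard_greedyDominated_le`). A rejected vertex had at most two uncovered vertices in its closed
neighbourhood, and later has no more; a chosen one has none left. So $|N[D]|\le|C|+2|D|$ for every
$D$, that is, $\partial(D)\le|C|$ (`differentialOf_le_ncard_greedyDominated`).

One pass over the rows of the adjacency matrix suffices, so a stack machine runs the greedy
algorithm with two bits per vertex and a counter cut off at 3. `runs_graph` bounds its running time
linearly in the input length. -/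

/-- The state of the greedy algorithm on the vertices `0, …, n - 1`, with `nb i j` telling whether
`j` lies in the closed neighbourhood of `i`: `greedyCovered n nb i j` tells whether `j` is covered
once the vertices below `i` have been treated. The vertex `i` is chosen if it covers at least three
new vertices. -/
def greedyCovered (n : ℕ) (nb : ℕ → ℕ → Bool) : ℕ → ℕ → Bool
  | 0, _ => false
  | i + 1, j => greedyCovered n nb i j ||
      (nb i j && decide (3 ≤ (List.range n).countP fun k => nb i k && !greedyCovered n nb i k))

/-- Whether the greedy algorithm chooses the vertex `i`. -/
def greedyChosen (n : ℕ) (nb : ℕ → ℕ → Bool) (i : ℕ) : Bool :=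
  decide (3 ≤ (List.range n).countP fun k => nb i k && !greedyCovered n nb i k)

theorem greedyCovered_succ (n : ℕ) (nb : ℕ → ℕ → Bool) (i j : ℕ) :
    greedyCovered n nb (i + 1) j = (greedyCovered n nb i j || (nb i j && greedyChosen n nb i)) :=
  rfl

theorem countP_range_eq_card (n : ℕ) (p : ℕ → Bool) :
    (List.range n).countP p = ((Finset.range n).filter fun k => p k).card := by
  induction n with
  | zero => simp
  | succ n ih =>
    rw [List.range_succ, List.countP_append, ih, Finset.range_add_one, Finset.filter_insert]
    by_cases h : p n <;> simp [h]

theorem greedyCovered_mono {n : ℕ} {nb : ℕ → ℕ → Bool} {i i' : ℕ} (h : i ≤ i') {j : ℕ}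
    (hj : greedyCovered n nb i j) : greedyCovered n nb i' j := by
  induction h with
  | refl => exact hj
  | step _ ih => simp [greedyCovered_succ, ih]

theorem greedyCovered_iff {n : ℕ} {nb : ℕ → ℕ → Bool} {i j : ℕ} :
    greedyCovered n nb i j ↔ ∃ k < i, greedyChosen n nb k ∧ nb k j := by
  induction i with
  | zero => simp [greedyCovered]
  | succ i ih =>
    simp only [greedyCovered_succ, Bool.or_eq_true, Bool.and_eq_true, ih, Nat.lt_succ_iff_lt_or_eq]
    constructor
    · rintro (⟨k, hk, h⟩ | ⟨h, h'⟩)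
      · exact ⟨k, Or.inl hk, h⟩
      · exact ⟨i, Or.inr rfl, h', h⟩
    · rintro ⟨k, hk | rfl, h⟩
      · exact Or.inl ⟨k, hk, h⟩
      · exact Or.inr ⟨h.2, h.1⟩

/-- Every chosen vertex pays for three covered ones. -/
theorem three_mul_card_greedyChosen_le (n : ℕ) (nb : ℕ → ℕ → Bool) (i : ℕ) :
    3 * ((Finset.range i).filter fun k => greedyChosen n nb k).card ≤
      ((Finset.range n).filter fun j => greedyCovered n nb i j).card := by
  induction i with
  | zero => simp
  | succ i ih =>
    rw [Finset.range_add_one, Finset.filter_insert]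
    by_cases h : greedyChosen n nb i
    · have hc := h
      rw [greedyChosen, countP_range_eq_card, decide_eq_true_eq] at hc
      -- The vertices counted at the choice of `i` were uncovered until then and are covered
      -- afterwards.
      have hd : Disjoint ((Finset.range n).filter fun j => greedyCovered n nb i j)
          ((Finset.range n).filter fun k => (nb i k && !greedyCovered n nb i k) = true) := by
        rw [Finset.disjoint_filter]
        intro k _ h1 h2
        simp [h1] at h2
      have hs : ((Finset.range n).filter fun j => greedyCovered n nb i j) ∪
          ((Finset.range n).filter fun k => (nb i k && !greedyCovered n nb i k) = true) ⊆
          (Finset.range n).filter fun j => greedyCovered n nb (i + 1) j := by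
        intro k
        simp only [Finset.mem_union, Finset.mem_filter, greedyCovered_succ, h]
        rintro (⟨h1, h2⟩ | ⟨h1, h2⟩)
        · simp [h1, h2]
        · simp only [Bool.and_eq_true] at h2
          simp [h1, h2.1]
      have := Finset.card_le_card hs
      rw [Finset.card_union_of_disjoint hd] at this
      rw [if_pos h, Finset.card_insert_of_notMem (by simp)]
      omega
    · rw [if_neg h]
      refine ih.trans (Finset.card_le_card fun k => ?_)
      simp only [Finset.mem_filter]
      exact fun hk => ⟨hk.1, greedyCovered_mono (Nat.le_succ i) hk.2⟩

/-- No vertex has more than two uncovered vertices in its closed neighbourhood in the end. -/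
theorem card_uncovered_le_two {n : ℕ} {nb : ℕ → ℕ → Bool} {i : ℕ} (hi : i < n) :
    ((Finset.range n).filter fun j => nb i j && !greedyCovered n nb n j).card ≤ 2 := by
  by_cases h : greedyChosen n nb i
  · rw [Finset.filter_false_of_mem]
    · simp
    · intro j _ hj
      simp only [Bool.and_eq_true, Bool.not_eq_true', ← Bool.not_eq_true] at hj
      exact hj.2 (greedyCovered_iff.2 ⟨i, hi, h, hj.1⟩)
  -- A rejected `i` saw at most two uncovered vertices at its turn, and the uncovered set only
  -- shrinks.
  · rw [greedyChosen, countP_range_eq_card, decide_eq_true_eq, not_le] at h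
    refine Nat.le_of_lt_succ (lt_of_le_of_lt (Finset.card_le_card fun k => ?_) h)
    simp only [Finset.mem_filter, Bool.and_eq_true, Bool.not_eq_true', ← Bool.not_eq_true]
    exact fun hk => ⟨hk.1, hk.2.1, fun hc => hk.2.2 (greedyCovered_mono hi.le hc)⟩

/-! ### The greedy set against the optimal differential -/

section Graph

variable {n : ℕ} (G : SimpleGraph (Fin n))

open Classical in
/-- The adjacency matrix of a graph on `Fin n`, extended by `false` to all natural numbers. -/
noncomputable def adjBit (i j : ℕ) : Bool :=
  decide (∃ (hi : i < n) (hj : j < n), G.Adj ⟨i, hi⟩ ⟨j, hj⟩)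

/-- Membership of `j` in the closed neighbourhood of `i`. -/
noncomputable def closedNbBit (i j : ℕ) : Bool := adjBit G i j || decide (j = i)

/-- The set of vertices that the greedy algorithm chooses. -/
def greedySet : Set (Fin n) := {i | greedyChosen n (closedNbBit G) i}

theorem adjBit_val (i j : Fin n) : adjBit G i j = true ↔ G.Adj i j := by
  simp [adjBit]

theorem closedNbBit_val (i j : Fin n) : closedNbBit G i j = true ↔ G.Adj i j ∨ j = i := by
  simp [closedNbBit, adjBit_val, Fin.ext_iff]

theorem ncard_setOf_val (p : ℕ → Bool) :
    {j : Fin n | p j}.ncard = ((Finset.range n).filter fun j => p j).card := by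
  rw [← Set.ncard_coe_finset, ← Set.ncard_image_of_injective _ Fin.val_injective]
  congr 1
  ext j
  simp only [Set.mem_image, Set.mem_ofPred_eq, Finset.coe_filter, Finset.mem_range]
  exact ⟨fun ⟨k, hk, e⟩ => e ▸ ⟨k.2, hk⟩, fun h => ⟨⟨j, h.1⟩, h.2, rfl⟩⟩

/-- The set of vertices that the greedy set dominates. -/
def greedyDominated : Set (Fin n) := {j | greedyCovered n (closedNbBit G) n j}

theorem three_mul_ncard_greedySet_le :
    3 * (greedySet G).ncard ≤ (greedyDominated G).ncard := by
  rw [greedySet, greedyDominated, ncard_setOf_val, ncard_setOf_val (greedyCovered n _ n)]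
  exact three_mul_card_greedyChosen_le n (closedNbBit G) n

theorem ncard_greedyDominated_le : ((greedyDominated G).ncard : ℤ) ≤
    3 * G.differentialOf (greedySet G) := by
  have hsub : greedyDominated G ⊆
      ((⋃ x ∈ greedySet G, G.neighborSet x) \ greedySet G) ∪ greedySet G := by
    intro j hj
    obtain ⟨k, hk, hc, hn⟩ := greedyCovered_iff.1 (show greedyCovered n (closedNbBit G) n j from hj)
    rw [Set.sdiff_union_self]
    rcases (closedNbBit_val G ⟨k, hk⟩ j).1 hn with h | rfl
    · exact Or.inl (Set.mem_iUnion₂.2 ⟨⟨k, hk⟩, hc, h⟩)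
    · exact Or.inr hc
  have h1 := (Set.ncard_le_ncard hsub (Set.toFinite _)).trans (Set.ncard_union_le _ _)
  have h2 := three_mul_ncard_greedySet_le G
  unfold SimpleGraph.differentialOf
  omega

theorem differentialOf_le_ncard_greedyDominated (D : Set (Fin n)) :
    G.differentialOf D ≤ (greedyDominated G).ncard := by
  classical
  -- This turns $\partial(D)$ into $|N[D]|-2|D|$; the $2|D|$ cancels the uncovered part of $N[D]$.
  have hd : ((⋃ x ∈ D, G.neighborSet x) \ D).ncard + D.ncard =
      ((⋃ x ∈ D, G.neighborSet x) ∪ D).ncard := by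
    rw [← Set.sdiff_union_self, Set.ncard_union_eq Set.disjoint_sdiff_left]
  have hsub : (⋃ x ∈ D, G.neighborSet x) ∪ D ⊆ greedyDominated G ∪ ⋃ x ∈ D.toFinset,
      {j : Fin n | closedNbBit G x j && !greedyCovered n (closedNbBit G) n j} := by
    intro j hj
    by_cases hc : j ∈ greedyDominated G
    · exact Or.inl hc
    · obtain ⟨x, hx, hxj⟩ : ∃ x ∈ D, closedNbBit G x j = true := by
        rcases hj with hj | hj
        · obtain ⟨x, hx, h⟩ := Set.mem_iUnion₂.1 hj
          exact ⟨x, hx, (closedNbBit_val G x j).2 (Or.inl h)⟩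
        · exact ⟨j, hj, (closedNbBit_val G j j).2 (Or.inr rfl)⟩
      refine Or.inr (Set.mem_biUnion (x := x) (by simpa using hx) ?_)
      have hc' : greedyCovered n (closedNbBit G) n j = false := by
        simpa [greedyDominated] using hc
      simp [hxj, hc']
  have h1 := (Set.ncard_le_ncard hsub (Set.toFinite _)).trans (Set.ncard_union_le _ _)
  have h2 := D.toFinset.set_ncard_biUnion_le
    fun x => {j : Fin n | closedNbBit G x j && !greedyCovered n (closedNbBit G) n j}
  have h3 : ∑ x ∈ D.toFinset,
      {j : Fin n | closedNbBit G x j && !greedyCovered n (closedNbBit G) n j}.ncard ≤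
      D.toFinset.card * 2 := by
    refine Finset.sum_le_card_nsmul _ _ _ fun x _ => ?_
    rw [ncard_setOf_val fun j => closedNbBit G x j && !greedyCovered n (closedNbBit G) n j]
    exact card_uncovered_le_two x.2
  rw [← Set.ncard_eq_toFinset_card'] at h3
  unfold SimpleGraph.differentialOf
  omega

/-- The greedy set is a factor-3 approximation of the optimum. -/
theorem differentialOf_le_three_mul (D : Set (Fin n)) :
    G.differentialOf D ≤ 3 * G.differentialOf (greedySet G) :=
  (differentialOf_le_ncard_greedyDominated G D).trans (ncard_greedyDominated_le G)

theorem encodeVertexSet_neighborSet (i : Fin n) :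
    encodeVertexSet (G.neighborSet i) = (List.range n).map (adjBit G i) := by
  rw [encodeVertexSet, ← List.map_coe_finRange_eq_range, List.map_map]
  refine List.map_congr_left fun j _ => ?_
  rw [Bool.eq_iff_iff]
  simp [adjBit_val]

theorem encodeVertexSet_greedySet :
    encodeVertexSet (greedySet G) = (List.range n).map (greedyChosen n (closedNbBit G)) := by
  rw [encodeVertexSet, ← List.map_coe_finRange_eq_range, List.map_map]
  refine List.map_congr_left fun j _ => ?_
  classical
  exact Bool.eq_iff_iff.2 decide_eq_true_iff

theorem encodeGraph_eq_flatMap_range :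
    encodeGraph ⟨n, G⟩ = (List.range n).flatMap fun i =>
      ((List.range n).map (adjBit G i)).map some ++ [none] := by
  rw [encodeGraph, ← List.map_coe_finRange_eq_range, List.flatMap_map]
  simp only [encodeVertexSet_neighborSet, List.map_coe_finRange_eq_range]

end Graph

/-! ### The machine -/

namespace GreedyMachine

open Turing

/-- The stacks of the machine. `cells` holds for each vertex whether it is covered and whether its
row has been read, `scanned` holds, in reverse order, the same data for the part of the current row
that has been read, together with membership in the closed neighbourhood of the current vertex, and
`chosen` the decisions made so far. -/
inductive Stack
  | input | cells | scanned | chosen | output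
  deriving DecidableEq

instance : Fintype Stack where
  elems := {.input, .cells, .scanned, .chosen, .output}
  complete s := by cases s <;> simp

/-- The alphabets of the stacks. -/
abbrev Alphabet : Stack → Type
  | .input => Option Bool
  | .cells => Bool × Bool
  | .scanned => Bool × Bool × Bool
  | .chosen => Bool
  | .output => Bool

/-- The labels of the program: `scan` reads a row, `restore` puts the cells back and updates the
covered vertices, `finish` writes the output. -/
inductive Label
  | scan | restore | finish
  deriving DecidableEq

instance : Fintype Label where
  elems := {.scan, .restore, .finish}
  complete l := by cases l <;> simp

/-- The internal state: the number of newly covered vertices, cut off at `3`, whether the diagonal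
entry of the current row has been passed, the last symbol read from the input, and a triple of bits
in transit from one stack to another. -/
abbrev State : Type := Fin 4 × Bool × Option (Option Bool) × Option (Bool × Bool × Bool)

/-- The cut-off of a natural number at `3`. -/
def cutoff (k : ℕ) : Fin 4 := ⟨min k 3, by omega⟩

/-- Update of the state when the row entry kept in the state meets the next cell: the first cell
not read before is the one on the diagonal. -/
def scanCell : State → Option (Bool × Bool) → State
  | (k, seen, x, _), a =>
    -- In the first row no cells exist yet; a missing cell stands for an uncovered, unread vertex.
    let c := a.getD (false, false)
    let diag := !c.2 && !seen
    let b := (x.getD none).getD false || diag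
    (cutoff (k + (b && !c.1).toNat), seen || diag, none, some (c.1, b, c.2 || diag))

open TM2.Stmt in
/-- The program. -/
def program : Label → TM2.Stmt Alphabet Label State
  | .scan =>
    pop Stack.input (fun s x => (s.1, s.2.1, x, none)) <|
    branch (fun s => s.2.2.1 == none)
      (load (fun _ => (0, false, none, none)) <| goto fun _ => .finish) <|
    branch (fun s => s.2.2.1 == some none)
      (push Stack.chosen (fun s => s.1 == 3) <|
        load (fun s => (s.1, s.2.1, none, none)) <| goto fun _ => .restore) <|
    pop Stack.cells scanCell <|
    push Stack.scanned (fun s => s.2.2.2.getD default) <|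
    load (fun s => (s.1, s.2.1, none, none)) <|
    goto fun _ => .scan
  | .restore =>
    pop Stack.scanned (fun s a => (s.1, s.2.1, none, a)) <|
    branch (fun s => s.2.2.2 == none)
      (load (fun _ => (0, false, none, none)) <| goto fun _ => .scan) <|
    push Stack.cells (fun s => let t := s.2.2.2.getD default
      (t.1 || (t.2.1 && s.1 == 3), t.2.2)) <|
    load (fun s => (s.1, s.2.1, none, none)) <|
    goto fun _ => .restore
  | .finish =>
    -- The halting configuration requires all stacks except the output to be empty.
    pop Stack.cells (fun s _ => s) <|
    pop Stack.chosen (fun _ e => (0, false, none, e.map fun b => (b, b, b))) <|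
    branch (fun s => s.2.2.2 == none)
      halt <|
    push Stack.output (fun s => (s.2.2.2.getD default).1) <|
    load (fun _ => (0, false, none, none)) <|
    goto fun _ => .finish

/-- The machine that runs the greedy algorithm. -/
def machine : FinTM2 where
  K := Stack
  k₀ := .input
  k₁ := .output
  Γ := Alphabet
  Λ := Label
  main := .scan
  σ := State
  initialState := (0, false, none, none)
  Γk₀Fin := inferInstanceAs (Fintype (Option Bool))
  m := program

/-- The configuration with given contents of the stacks. -/
def stackCfg (l : Option Label) (k : ℕ) (seen : Bool) (i : List (Option Bool))
    (a : List (Bool × Bool)) (b : List (Bool × Bool × Bool)) (e o : List Bool) : machine.Cfg where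
  l := l
  var := (cutoff k, seen, none, none)
  stk
    | .input => i
    | .cells => a
    | .scanned => b
    | .chosen => e
    | .output => o

/-- `Runs t c d`: the machine gets from `c` to `d` in exactly `t` steps. -/
def Runs (t : ℕ) (c d : machine.Cfg) : Prop := (flip bind machine.step)^[t] (some c) = some d

theorem Runs.trans {t u : ℕ} {c d e : machine.Cfg} (h : Runs t c d) (h' : Runs u d e) :
    Runs (t + u) c e := by
  unfold Runs at *
  rw [Nat.add_comm, Function.iterate_add_apply, h, h']

/-- Lets the finite counter of the machine follow the true count of new vertices. -/
theorem cutoff_add (k m : ℕ) : cutoff ((cutoff k : ℕ) + m) = cutoff (k + m) := by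
  simp only [cutoff, Fin.mk.injEq]
  omega

theorem cutoff_beq (k : ℕ) : (cutoff k == 3) = decide (3 ≤ k) := by
  rw [Bool.eq_iff_iff, beq_iff_eq, decide_eq_true_eq, Fin.ext_iff]
  simp only [cutoff]
  change min k 3 = 3 ↔ _
  omega

/-- Stacks are compared one by one: updated stack families agree with the target by computation only
at each concrete stack. -/
theorem runs_one {c d : machine.Cfg} {l : Label} (hc : c.l = some l)
    (hl : (TM2.stepAux (program l) c.var c.stk).l = d.l)
    (hv : (TM2.stepAux (program l) c.var c.stk).var = d.var)
    (hs : ∀ k, (TM2.stepAux (program l) c.var c.stk).stk k = d.stk k) : Runs 1 c d := by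
  obtain ⟨l', v, S⟩ := c
  obtain rfl : l' = some l := hc
  change some (TM2.stepAux (program l) v S) = some d
  obtain ⟨l'', v', S'⟩ := d
  generalize TM2.stepAux (program l) v S = x at hl hv hs
  obtain ⟨_, _, _⟩ := x
  obtain rfl := hl
  obtain rfl := hv
  obtain rfl := funext hs
  rfl

/-! ### Single steps of the machine -/

theorem runs_scan_bit (k : ℕ) (seen r : Bool) (i a b e o) :
    Runs 1 (stackCfg (some .scan) k seen (some r :: i) a b e o)
      (let c := a.head?.getD (false, false)
       let diag := !c.2 && !seen
       stackCfg (some .scan) (k + ((r || diag) && !c.1).toNat) (seen || diag) i a.tail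
        ((c.1, r || diag, c.2 || diag) :: b) e o) := by
  refine runs_one rfl rfl ?_ fun s => ?_
  · dsimp only [stackCfg]
    rw [← cutoff_add]
    rfl
  · cases s <;> rfl

theorem runs_scan_none (k : ℕ) (seen : Bool) (i a b e o) :
    Runs 1 (stackCfg (some .scan) k seen (none :: i) a b e o)
      (stackCfg (some .restore) k seen i a b (decide (3 ≤ k) :: e) o) := by
  rw [← cutoff_beq]
  exact runs_one rfl rfl rfl fun s => by cases s <;> rfl

theorem runs_scan_nil (k : ℕ) (seen : Bool) (a b e o) :
    Runs 1 (stackCfg (some .scan) k seen [] a b e o) (stackCfg (some .finish) 0 false [] a b e o) :=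
  runs_one rfl rfl rfl fun s => by cases s <;> rfl

theorem runs_restore_cons (k : ℕ) (seen : Bool) (t : Bool × Bool × Bool) (i a b e o) :
    Runs 1 (stackCfg (some .restore) k seen i a (t :: b) e o)
      (stackCfg (some .restore) k seen i ((t.1 || (t.2.1 && decide (3 ≤ k)), t.2.2) :: a) b e o) := by
  rw [← cutoff_beq]
  exact runs_one rfl rfl rfl fun s => by cases s <;> rfl

theorem runs_restore_nil (k : ℕ) (seen : Bool) (i a e o) :
    Runs 1 (stackCfg (some .restore) k seen i a [] e o) (stackCfg (some .scan) 0 false i a [] e o) :=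
  runs_one rfl rfl rfl fun s => by cases s <;> rfl

theorem runs_finish_cons (i a b) (x : Bool) (e o) :
    Runs 1 (stackCfg (some .finish) 0 false i a b (x :: e) o)
      (stackCfg (some .finish) 0 false i a.tail b e (x :: o)) :=
  runs_one rfl rfl rfl fun s => by cases s <;> rfl

theorem runs_finish_nil (i b o) :
    Runs 1 (stackCfg (some .finish) 0 false i [] b [] o) (stackCfg none 0 false i [] b [] o) :=
  runs_one rfl rfl rfl fun s => by cases s <;> rfl

/-- Reading the entries `k, …, k + m - 1` of row `i`. The stack of cells is empty during the first
row. -/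
theorem runs_scan_row (r c : ℕ → Bool) (i : ℕ) (inp e o) (m : ℕ) : ∀ (k cnt : ℕ) (a b),
    (a = (List.range' k m).map (fun j => (c j, decide (j < i))) ∨
      (a = [] ∧ i = 0 ∧ ∀ j, c j = false)) →
    Runs m (stackCfg (some .scan) cnt (decide (i < k)) ((List.range' k m).map (some ∘ r) ++ inp)
        a b e o)
      (stackCfg (some .scan)
        (cnt + (List.range' k m).countP fun j => (r j || decide (j = i)) && !c j)
        (decide (i < k + m)) inp []
        (((List.range' k m).map fun j =>
          (c j, r j || decide (j = i), decide (j < i + 1))).reverse ++ b) e o) := by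
  induction m with
  | zero =>
    intro k cnt a b ha
    obtain rfl : a = [] := by rcases ha with rfl | ha <;> [rfl; exact ha.1]
    rfl
  | succ m ih =>
    intro k cnt a b ha
    have hhead : a.head?.getD (false, false) = (c k, decide (k < i)) := by
      rcases ha with rfl | ⟨rfl, rfl, h⟩
      · simp [List.range'_succ]
      · simp [h]
    have htail : a.tail = (List.range' (k + 1) m).map (fun j => (c j, decide (j < i))) ∨
        (a.tail = [] ∧ i = 0 ∧ ∀ j, c j = false) := by
      rcases ha with rfl | ⟨rfl, h⟩
      · simp [List.range'_succ]
      · exact Or.inr ⟨rfl, h⟩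
    -- Unread means `i ≤ k`, and diagonal not yet passed means `k ≤ i`; so the machine finds the
    -- diagonal without storing an index.
    have hdiag : (!decide (k < i) && !decide (i < k)) = decide (k = i) := by
      rw [Bool.eq_iff_iff]
      simp only [Bool.and_eq_true, Bool.not_eq_true', decide_eq_false_iff_not, decide_eq_true_eq]
      omega
    have hseen : (decide (i < k) || decide (k = i)) = decide (i < k + 1) := by
      rw [Bool.eq_iff_iff]
      simp only [Bool.or_eq_true, decide_eq_true_eq]
      omega
    have hread : (decide (k < i) || decide (k = i)) = decide (k < i + 1) := by
      rw [Bool.eq_iff_iff]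
      simp only [Bool.or_eq_true, decide_eq_true_eq]
      omega
    have h1 := runs_scan_bit cnt (decide (i < k)) (r k)
      ((List.range' (k + 1) m).map (some ∘ r) ++ inp) a b e o
    simp only [hhead, hdiag, hseen, hread] at h1
    have h2 := h1.trans (ih (k + 1) _ _ _ htail)
    rw [Nat.add_comm 1 m] at h2
    convert h2 using 2
    · simp [List.range'_succ]
    · rw [List.range'_succ, List.countP_cons]
      cases (r k || decide (k = i)) && !c k <;> simp
      omega
    · rw [Nat.add_assoc, Nat.add_comm 1 m]
    · simp [List.range'_succ]

theorem runs_restore (k : ℕ) (seen : Bool) (inp e o) (b : List (Bool × Bool × Bool)) : ∀ a,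
    Runs (b.length + 1) (stackCfg (some .restore) k seen inp a b e o)
      (stackCfg (some .scan) 0 false inp
        ((b.map fun t => (t.1 || (t.2.1 && decide (3 ≤ k)), t.2.2)).reverse ++ a) [] e o) := by
  induction b with
  | nil => exact fun a => runs_restore_nil k seen inp a e o
  | cons t b ih =>
    intro a
    have h := (runs_restore_cons k seen t inp a b e o).trans (ih _)
    rw [List.length_cons, Nat.add_comm b.length 1, Nat.add_assoc]
    simpa using h

/-- The last decision lies on top of `e`, so moving it over puts vertex 0 first in the output. The
length bound ensures that the cells run out in time. -/
theorem runs_finish (e : List Bool) : ∀ (a : List (Bool × Bool)) (o), a.length ≤ e.length →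
    Runs (e.length + 1) (stackCfg (some .finish) 0 false [] a [] e o)
      (stackCfg none 0 false [] [] [] [] (e.reverse ++ o)) := by
  induction e with
  | nil =>
    intro a o ha
    obtain rfl : a = [] := by simpa using ha
    exact runs_finish_nil [] [] o
  | cons x e ih =>
    intro a o ha
    have h := (runs_finish_cons [] a [] x e o).trans (ih a.tail (x :: o) (by simpa using ha))
    rw [List.length_cons, Nat.add_comm e.length 1, Nat.add_assoc]
    simpa using h

theorem initList_machine (l : List (Option Bool)) :
    initList machine l = stackCfg (some .scan) 0 false l [] [] [] [] :=
  congrArg (TM2.Cfg.mk _ _) (funext fun s => by cases s <;> rfl)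

theorem haltList_machine (l : List Bool) :
    haltList machine l = stackCfg none 0 false [] [] [] [] l :=
  congrArg (TM2.Cfg.mk _ _) (funext fun s => by cases s <;> rfl)

/-! ### The complete run on a graph -/

section Run

variable {n : ℕ} (G : SimpleGraph (Fin n))

/-- The cells after the treatment of the vertices below `i`. -/
noncomputable def cellsAt (i : ℕ) : List (Bool × Bool) :=
  (List.range n).map fun j => (greedyCovered n (closedNbBit G) i j, decide (j < i))

/-- The time is `n` entries, one separator, `n` cells restored and one step to notice the empty
stack. -/
theorem runs_row (i : ℕ) (inp a e o) (ha : a = cellsAt G i ∨ (a = [] ∧ i = 0)) :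
    Runs (2 * n + 2)
      (stackCfg (some .scan) 0 false
        (((List.range n).map (adjBit G i)).map some ++ [none] ++ inp) a [] e o)
      (stackCfg (some .scan) 0 false inp (cellsAt G (i + 1)) []
        (greedyChosen n (closedNbBit G) i :: e) o) := by
  have h1 := runs_scan_row (adjBit G i) (greedyCovered n (closedNbBit G) i) i (none :: inp) e o n
    0 0 a [] (by
      rw [← List.range_eq_range']
      refine ha.imp id ?_
      rintro ⟨rfl, rfl⟩
      exact ⟨rfl, rfl, fun _ => rfl⟩)
  rw [← List.range_eq_range', List.append_nil, Nat.zero_add, Nat.zero_add] at h1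
  have h2 := (h1.trans (runs_scan_none _ _ inp _ _ e o)).trans (runs_restore _ _ inp _ o _ _)
  rw [List.length_reverse, List.length_map, List.length_range] at h2
  have ht : n + 1 + (n + 1) = 2 * n + 2 := by omega
  rw [ht] at h2
  convert h2 using 2
  · simp
  · simp
  · rw [List.append_nil, List.map_reverse, List.reverse_reverse, List.map_map]
    rfl
  · rfl

theorem runs_rows (m : ℕ) : ∀ (i : ℕ) (a), i + m = n → (a = cellsAt G i ∨ (a = [] ∧ i = 0)) →
    ∃ a', a'.length ≤ n ∧ Runs (m * (2 * n + 2))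
      (stackCfg (some .scan) 0 false
        ((List.range' i m).flatMap fun i => ((List.range n).map (adjBit G i)).map some ++ [none])
        a [] ((List.range i).map (greedyChosen n (closedNbBit G))).reverse [])
      (stackCfg (some .scan) 0 false [] a' []
        ((List.range n).map (greedyChosen n (closedNbBit G))).reverse []) := by
  induction m with
  | zero =>
    rintro i a rfl ha
    refine ⟨a, ?_, by rw [Nat.zero_mul]; rfl⟩
    rcases ha with rfl | ⟨rfl, _⟩ <;> simp [cellsAt]
  | succ m ih =>
    intro i a hi ha
    obtain ⟨a', ha', h'⟩ := ih (i + 1) (cellsAt G (i + 1)) (by omega) (Or.inl rfl)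
    refine ⟨a', ha', ?_⟩
    rw [List.range_succ, List.map_append, List.reverse_append] at h'
    rw [List.range'_succ, List.flatMap_cons, Nat.succ_mul, Nat.add_comm]
    exact (runs_row G i _ a _ [] ha).trans h'

theorem runs_graph : ∃ t ≤ 3 * (n * (n + 1)) + 2,
    Runs t (initList machine (encodeGraph ⟨n, G⟩))
      (haltList machine (encodeVertexSet (greedySet G))) := by
  obtain ⟨a, ha, h⟩ := runs_rows G n 0 [] (Nat.zero_add n) (Or.inr ⟨rfl, rfl⟩)
  have h' := (h.trans (runs_scan_nil 0 false a [] _ [])).trans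
    (runs_finish _ a [] (by simpa using ha))
  rw [List.append_nil, List.reverse_reverse, List.length_reverse, List.length_map,
    List.length_range, ← List.range_eq_range', ← encodeGraph_eq_flatMap_range,
    ← encodeVertexSet_greedySet] at h'
  rw [initList_machine, haltList_machine]
  -- The exact time is $n(2n+2)+1+(n+1)$.
  exact ⟨_, by nlinarith, h'⟩

end Run

/-- The greedy set is computable in polynomial time. -/
noncomputable def greedyComputable : TM2ComputableInPolyTime encodeGraph (id : List Bool → _)
    (fun G => encodeVertexSet (greedySet G.2)) where
  tm := machine
  inputAlphabet := Equiv.refl (Option Bool)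
  outputAlphabet := Equiv.refl Bool
  time := 3 * Polynomial.X + 2
  outputsFun G :=
    { steps := (runs_graph G.2).choose
      evals_in_steps := by
        have h := (runs_graph G.2).choose_spec.2
        have hi : List.map (Equiv.refl (Option Bool)).invFun (encodeGraph G) = encodeGraph G :=
          List.map_id _
        have ho : List.map (Equiv.refl Bool).invFun (encodeVertexSet (greedySet G.2)) =
          encodeVertexSet (greedySet G.2) := List.map_id _
        refine Eq.trans ?_ (Eq.trans h ?_)
        · exact congrArg (fun l => (flip bind machine.step)^[_] (some (initList machine l))) hi
        · exact congrArg (fun l => some (haltList machine l)) ho.symm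
      steps_le_m := by
        rw [encodeGraph_length]
        simpa using (runs_graph G.2).choose_spec.1 }

end GreedyMachine

theorem mainTheorem2 : differentialProblem.PolyTimeApproximable (11 / 3) := by
  refine ⟨fun G => greedySet G.2, fun G => ?_, ⟨GreedyMachine.greedyComputable⟩⟩
  obtain ⟨D, hD⟩ := Finite.exists_max fun D : Set (Fin G.1) => G.2.differentialOf D
  refine ⟨G.2.differentialOf D, ⟨⟨D, rfl⟩, ?_⟩, ?_⟩
  · rintro _ ⟨D', rfl⟩
    exact hD D'
  · have h := differentialOf_le_three_mul G.2 D
    have h0 := ncard_greedyDominated_le G.2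
    change ((G.2.differentialOf D : ℤ) : ℝ) ≤ 11 / 3 * (G.2.differentialOf (greedySet G.2) : ℝ)
    have h1 : ((G.2.differentialOf D : ℤ) : ℝ) ≤ 3 * (G.2.differentialOf (greedySet G.2) : ℝ) := by
      exact_mod_cast h
    -- Nonnegativity allows the factor 3 to be weakened to 11/3.
    have h2 : (0 : ℝ) ≤ (G.2.differentialOf (greedySet G.2) : ℝ) := by
      exact_mod_cast (by omega : 0 ≤ G.2.differentialOf (greedySet G.2))
    linarith
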